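/- For positive integers $g,h,N$, a set $A\subseteq\{1,\dots,N\}$ is a $B_h[g]$-set if every $x\in\mathbb Z$ has at most $g$ representations $x=a_1+\dots+a_h$ with $a_1,\dots,a_h\in A$, where representations that are permutations of each other are considered the same. Let $R_h[g](N)$ be the largest size of a $B_h[g]$-set contained in $\{1,\dots,N\}$, and put $$\sigma_h(g)=\limsup_{N\to\infty}\frac{R_h[g](N)}{(gN)^{1/h}} .$$ Let $\mathcal F$ be the set of integrable functions $f\colon\mathbb R\to\mathbb R$ supported in $[-1/2,1/2]$ with $\int f=1$, and let $$\mu_2=\inf_{f\in\mathcal F}\|f*f\|_{2}=\inf_{f\in\mathcal F}\left(\int_{-1}^{1}\Big|\int_{-1/2}^{1/2}f(t)f(x-t)\,dt\Big|^2dx\right)^{1/2}.$$ Then $$\sigma_2(g)\le\left(\frac{2-1/g}{\mu_2^2}\right)^{1/2}\ \text{ for every integer } g\ge 1,\qquad \sigma_3(1)\le\left(\frac{2}{\mu_2^2}\right)^{1/3},\qquad \sigma_4(1)\le\left(\frac{4}{\mu_2^2}\right)^{1/4}.$$ -/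

import Mathlib

open MeasureTheory Filter
open scoped ENNReal Convolution

/-- `A` is a `B_h[g]`-set: every integer `x` has at most `g` representations
`x = a₁ + ⋯ + a_h` with all `aᵢ ∈ A`, where representations that are permutations of each other
are identified, that is, a representation is a multiset of `h` elements of `A`
(an element of `A.sym h`). -/
def IsBhgSet (h g : ℕ) (A : Finset ℤ) : Prop :=
  ∀ x : ℤ, ((A.sym h).filter (fun s : Sym ℤ h => (s : Multiset ℤ).sum = x)).card ≤ g

open Classical in
/-- `R_h[g](N)`: the largest size of a `B_h[g]`-set contained in `{1, …, N}`. -/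
noncomputable def maxBhg (h g N : ℕ) : ℕ :=
  ((Finset.Icc (1 : ℤ) (N : ℤ)).powerset.filter (fun A => IsBhgSet h g A)).sup Finset.card

/-- The limsup version of `σ_h(g)`: the upper limit of `R_h[g](N) / (g N)^(1/h)` as `N → ∞`,
taken in the extended reals, so that it is `⊤` if the sequence is not bounded above. -/
noncomputable def sigmaSup (h g : ℕ) : EReal :=
  limsup (fun N : ℕ =>
    (((maxBhg h g N : ℝ) / ((g : ℝ) * (N : ℝ)) ^ (1 / (h : ℝ)) : ℝ) : EReal)) atTop

/-- The family `𝓕` of integrable real functions supported in `[-1/2, 1/2]` with integral `1`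
(of arbitrary sign). -/
def unitFamily : Set (ℝ → ℝ) :=
  {f | Integrable f ∧ Function.support f ⊆ Set.Icc (-1 / 2) (1 / 2) ∧ ∫ x, f x = 1}

/-- `μ_p = inf_{f ∈ 𝓕} ‖f ∗ f‖_p`, where `f ∗ f (x) = ∫ f(t) f(x - t) dt`.
The infimum is taken in `[0, ∞]`: the norm is `∞` if `f ∗ f` is not in `L^p`. -/
noncomputable def muAutoconv (p : ℝ≥0∞) : ℝ :=
  (⨅ f ∈ unitFamily, eLpNorm (f ⋆[ContinuousLinearMap.mul ℝ ℝ, volume] f) p volume).toReal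

open scoped Topology

/-! Smear each point of a `B_h[g]`-set `A ⊆ {1, …, N}` into a uniform density on an interval of
length `u`. The sum `F` of these densities has integral `|A|` and lives on an interval of length `N
+ u`, so rescaling gives `μ₂² |A|⁴ ≤ (N + u) ‖F ∗ F‖₂²` (`muAutoconv_sq_mul_card_le`).

The squared norm is `∑ V(a + b - c - d)` over quadruples from `A`, where `V = tentCorr u ≥ 0` has
total mass at most `1` on the integers and is at most `1/u` pointwise. Quadruples in which `{a, b}`
meets `{c, d}` contribute at most `4|A|³/u`, negligible for `u = εN`. On the others the hypothesis
on `A` bounds the sum by `C|A|^(4-h)`: - `h = 4`: each value of `a + b - c - d` occurs at most 4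
times, so `C = 4`; - `h = 3`: for fixed `d` each value occurs at most twice, so `C = 2`; - `h = 2`:
Schur's test for the kernel `V` on the differences `a - c` and `d - b` reduces the sum to additive
energy without its diagonal, so `C = 2g - 1`.

Letting `N → ∞` and then `ε → 0` gives `σ_h(g)^h ≤ C / (g μ₂²)`. -/

/-! ### Autoconvolutions and the constant `μ₂` -/

/-- The autoconvolution `f ∗ f` of a real function. -/
noncomputable abbrev autoconv (f : ℝ → ℝ) : ℝ → ℝ :=
  f ⋆[ContinuousLinearMap.mul ℝ ℝ, volume] f

theorem autoconv_apply (f : ℝ → ℝ) (x : ℝ) : autoconv f x = ∫ t, f t * f (x - t) := rfl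

theorem integrable_autoconv {f : ℝ → ℝ} (hf : Integrable f) : Integrable (autoconv f) :=
  hf.integrable_convolution _ hf

theorem integral_autoconv {f : ℝ → ℝ} (hf : Integrable f) :
    ∫ x, autoconv f x = (∫ x, f x) ^ 2 := by
  rw [autoconv, integral_convolution _ hf hf, ContinuousLinearMap.mul_apply', sq]

theorem eLpNorm_two_eq_sqrt {f : ℝ → ℝ} (hf : MemLp f 2) :
    eLpNorm f 2 = ENNReal.ofReal (√(∫ x, f x ^ 2)) := by
  rw [hf.eLpNorm_eq_integral_rpow_norm (by simp) (by simp), Real.sqrt_eq_rpow]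
  simp

/-- Square integrability is essential: otherwise the Bochner integral on the right would default to
`0`. -/
theorem muAutoconv_sq_le {f : ℝ → ℝ} (hf : f ∈ unitFamily) (h2 : MemLp (autoconv f) 2) :
    muAutoconv 2 ^ 2 ≤ ∫ x, autoconv f x ^ 2 := by
  have h : muAutoconv 2 ≤ √(∫ x, autoconv f x ^ 2) := by
    rw [← ENNReal.toReal_ofReal (Real.sqrt_nonneg _), ← eLpNorm_two_eq_sqrt h2]
    exact ENNReal.toReal_mono h2.2.ne (iInf₂_le f hf)
  calc muAutoconv 2 ^ 2 ≤ √(∫ x, autoconv f x ^ 2) ^ 2 :=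
        pow_le_pow_left₀ ENNReal.toReal_nonneg h 2
    _ = _ := Real.sq_sqrt (integral_nonneg fun x => sq_nonneg _)

/-- Cauchy–Schwarz on `[-1, 1]`, which has length 2 and carries all of `f ∗ f`, whose integral is
`1`. -/
theorem one_le_two_rpow_mul_eLpNorm {f : ℝ → ℝ} (hf : f ∈ unitFamily) :
    1 ≤ eLpNorm (autoconv f) 2 * (2 : ℝ≥0∞) ^ (1 / 2 : ℝ) := by
  obtain ⟨hi, hs, h1⟩ := hf
  have hsupp : Function.support (autoconv f) ⊆ Set.Icc (-1) 1 := by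
    refine (support_convolution_subset _).trans ?_
    rintro x ⟨a, ha, b, hb, rfl⟩
    have ha' := hs ha
    have hb' := hs hb
    simp only [Set.mem_Icc] at ha' hb' ⊢
    constructor <;> linarith
  have hint : ∫ x in Set.Icc (-1 : ℝ) 1, autoconv f x = 1 := by
    rw [setIntegral_eq_integral_of_forall_compl_eq_zero
      (fun x hx => Function.notMem_support.1 fun h => hx (hsupp h)), integral_autoconv hi, h1]
    norm_num
  have hI := integrable_autoconv hi
  have hA : (1 : ℝ≥0∞) ≤ eLpNorm (autoconv f) 1 (volume.restrict (Set.Icc (-1 : ℝ) 1)) := by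
    rw [eLpNorm_one_eq_lintegral_enorm]
    calc (1 : ℝ≥0∞) = ‖∫ x in Set.Icc (-1 : ℝ) 1, autoconv f x‖ₑ := by rw [hint]; simp
      _ ≤ _ := enorm_integral_le_lintegral_enorm _
  have hB := eLpNorm_le_eLpNorm_mul_rpow_measure_univ (p := 1) (q := 2)
    (μ := volume.restrict (Set.Icc (-1 : ℝ) 1)) (by norm_num) hI.aestronglyMeasurable.restrict
  refine hA.trans (hB.trans ?_)
  gcongr ?_ * ?_
  · exact eLpNorm_mono_measure _ Measure.restrict_le_self
  · simp only [Measure.restrict_apply_univ, Real.volume_Icc]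
    norm_num

/-- The infimum `μ₂` is positive as soon as it is finite, by the Cauchy–Schwarz inequality. -/
theorem muAutoconv_two_pos_of_mem {f : ℝ → ℝ} (hf : f ∈ unitFamily) (h2 : MemLp (autoconv f) 2) :
    0 < muAutoconv 2 := by
  refine ENNReal.toReal_pos ?_ ((iInf₂_le f hf).trans_lt h2.2).ne
  have h : ((2 : ℝ≥0∞) ^ (1 / 2 : ℝ))⁻¹ ≤ ⨅ f ∈ unitFamily, eLpNorm (autoconv f) 2 volume :=
    le_iInf₂ fun f hf => by
      rw [ENNReal.inv_le_iff_le_mul] <;> simp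
      simpa [mul_comm] using one_le_two_rpow_mul_eLpNorm hf
  refine fun h0 => ?_
  rw [h0] at h
  simp at h

theorem autoconv_bound {f : ℝ → ℝ} (hf : Integrable f) {C : ℝ} (hC : ∀ x, |f x| ≤ C) (x : ℝ) :
    |autoconv f x| ≤ (∫ t, |f t|) * C := by
  rw [autoconv_apply, ← integral_mul_const]
  refine (abs_integral_le_integral_abs).trans (integral_mono_of_nonneg ?_ (hf.abs.mul_const C) ?_)
  · exact ae_of_all _ fun t => abs_nonneg _
  · refine ae_of_all _ fun t => ?_
    simp only [abs_mul]
    exact mul_le_mul_of_nonneg_left (hC _) (abs_nonneg _)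

/-- Bounded integrable functions have square integrable autoconvolution. -/
theorem memLp_two_autoconv {f : ℝ → ℝ} (hf : Integrable f) {C : ℝ} (hC : ∀ x, |f x| ≤ C) :
    MemLp (autoconv f) 2 := by
  have hI := integrable_autoconv hf
  rw [memLp_two_iff_integrable_sq hI.aestronglyMeasurable]
  simp only [sq]
  exact hI.bdd_mul hI.aestronglyMeasurable (ae_of_all _ fun x => autoconv_bound hf hC x)

/-! ### Rescaling to the unit interval -/

/-- The rescaling of a function on `[0, M]` with integral `X` to a member of `unitFamily`. -/
noncomputable def rescale (M X : ℝ) (F : ℝ → ℝ) (x : ℝ) : ℝ := M / X * F (M * (x + 1 / 2))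

section rescale

variable {F : ℝ → ℝ} {M X : ℝ}

theorem integral_comp_affine (g : ℝ → ℝ) (hM : 0 < M) (c : ℝ) :
    ∫ x, g (M * (x + c)) = M⁻¹ * ∫ x, g x := by
  rw [integral_add_right_eq_self (fun x => g (M * x)) c, Measure.integral_comp_mul_left,
    abs_of_pos (inv_pos.2 hM), smul_eq_mul]

theorem rescale_mem_unitFamily (hF : Integrable F) (hs : Function.support F ⊆ Set.Icc 0 M)
    (hM : 0 < M) (hX : 0 < X) (hint : ∫ x, F x = X) : rescale M X F ∈ unitFamily := by
  refine ⟨?_, ?_, ?_⟩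
  · exact ((hF.comp_mul_left' hM.ne').comp_add_right (1 / 2)).const_mul _
  · intro x hx
    have hx' : F (M * (x + 1 / 2)) ≠ 0 := fun h => hx (by rw [rescale, h, mul_zero])
    obtain ⟨h1, h2⟩ := hs hx'
    have h3 : 0 ≤ x + 1 / 2 := nonneg_of_mul_nonneg_right h1 hM
    have h4 : x + 1 / 2 ≤ 1 := by
      by_contra h
      nlinarith
    constructor <;> linarith
  · simp only [rescale]
    rw [integral_const_mul, integral_comp_affine _ hM, hint]
    field_simp

theorem autoconv_rescale (hM : 0 < M) (x : ℝ) :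
    autoconv (rescale M X F) x = M / X ^ 2 * autoconv F (M * (x + 1)) := by
  simp only [autoconv_apply, rescale]
  have h : ∀ t, M / X * F (M * (t + 1 / 2)) * (M / X * F (M * (x - t + 1 / 2))) =
      (M / X) ^ 2 * (fun s => F s * F (M * (x + 1) - s)) (M * (t + 1 / 2)) := fun t => by
    simp only
    rw [show M * (x + 1) - M * (t + 1 / 2) = M * (x - t + 1 / 2) by ring]
    ring
  simp only [h]
  rw [integral_const_mul, integral_comp_affine (fun s => F s * F (M * (x + 1) - s)) hM]
  field_simp

theorem integral_autoconv_rescale_sq (hM : 0 < M) :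
    ∫ x, autoconv (rescale M X F) x ^ 2 = M / X ^ 4 * ∫ x, autoconv F x ^ 2 := by
  simp only [autoconv_rescale hM, mul_pow]
  rw [integral_const_mul, integral_comp_affine (fun y => autoconv F y ^ 2) hM]
  field_simp

theorem rescale_abs_le (hM : 0 < M) (hX : 0 < X) {C : ℝ} (hC : ∀ x, |F x| ≤ C) (x : ℝ) :
    |rescale M X F x| ≤ M / X * C := by
  rw [rescale, abs_mul, abs_of_pos (div_pos hM hX)]
  exact mul_le_mul_of_nonneg_left (hC _) (div_pos hM hX).le

theorem muAutoconv_sq_mul_le (hF : Integrable F) (hs : Function.support F ⊆ Set.Icc 0 M)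
    (hM : 0 < M) (hX : 0 < X) (hint : ∫ x, F x = X) {C : ℝ} (hC : ∀ x, |F x| ≤ C) :
    muAutoconv 2 ^ 2 * X ^ 4 ≤ M * ∫ x, autoconv F x ^ 2 := by
  have hmem := rescale_mem_unitFamily hF hs hM hX hint
  have h := muAutoconv_sq_le hmem (memLp_two_autoconv hmem.1 (rescale_abs_le hM hX hC))
  rw [integral_autoconv_rescale_sq hM, div_mul_eq_mul_div, le_div_iff₀ (by positivity)] at h
  exact h

end rescale

/-! ### Box and tent functions, and the quadruple sum -/

/-- The uniform probability density on `[0, u)`. -/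
noncomputable def boxDensity (u : ℕ) : ℝ → ℝ :=
  (Set.Ico (0 : ℝ) u).indicator fun _ => (u : ℝ)⁻¹

section box

variable {u : ℕ}

theorem boxDensity_nonneg (x : ℝ) : 0 ≤ boxDensity u x :=
  Set.indicator_nonneg (fun _ _ => by positivity) _

theorem boxDensity_le (x : ℝ) : boxDensity u x ≤ (u : ℝ)⁻¹ :=
  Set.indicator_le_self' (fun _ _ => by positivity) _

theorem boxDensity_abs_le (x : ℝ) : |boxDensity u x| ≤ (u : ℝ)⁻¹ := by
  rw [abs_of_nonneg (boxDensity_nonneg x)]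
  exact boxDensity_le x

theorem support_boxDensity : Function.support (boxDensity u) ⊆ Set.Ico (0 : ℝ) u :=
  Set.support_indicator_subset

theorem measurable_boxDensity : Measurable (boxDensity u) :=
  measurable_const.indicator measurableSet_Ico

theorem integrable_boxDensity : Integrable (boxDensity u) := by
  rw [boxDensity, integrable_indicator_iff measurableSet_Ico]
  exact integrableOn_const (by simp)

theorem integral_boxDensity (hu : 0 < u) : ∫ x, boxDensity u x = 1 := by
  rw [boxDensity, integral_indicator measurableSet_Ico]
  simp [hu.ne']

/-- A half-open interval of length `u` contains exactly `u` points of `x + ℤ`; a closed one could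
contain `u + 1`. -/
theorem sum_boxDensity_le (x : ℝ) (S : Finset ℤ) : ∑ k ∈ S, boxDensity u (x + k) ≤ 1 := by
  rcases Nat.eq_zero_or_pos u with rfl | hu
  · simp [boxDensity]
  have hsub : S.filter (fun k : ℤ => x + k ∈ Set.Ico (0 : ℝ) u) ⊆
      Finset.Ico ⌈-x⌉ (⌈-x⌉ + u) := by
    intro k hk
    obtain ⟨-, h1, h2⟩ := Finset.mem_filter.1 hk
    rw [Finset.mem_Ico]
    constructor
    · rw [Int.ceil_le]; linarith
    · have h3 := Int.le_ceil (-x)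
      have : (k : ℝ) < ((⌈-x⌉ + u : ℤ) : ℝ) := by push_cast; linarith
      exact_mod_cast this
  have hcard := Finset.card_le_card hsub
  simp only [Int.card_Ico, add_sub_cancel_left, Int.toNat_natCast] at hcard
  have h0 : (0 : ℝ) < u := by exact_mod_cast hu
  calc ∑ k ∈ S, boxDensity u (x + k)
      = ∑ k ∈ S.filter (fun k : ℤ => x + k ∈ Set.Ico (0 : ℝ) u), (u : ℝ)⁻¹ := by
        rw [Finset.sum_filter]
        exact Finset.sum_congr rfl fun k _ => by simp [boxDensity, Set.indicator_apply]
    _ ≤ u * (u : ℝ)⁻¹ := by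
        rw [Finset.sum_const, nsmul_eq_mul]
        gcongr
    _ = 1 := mul_inv_cancel₀ h0.ne'

/-- The tent function `boxDensity u ∗ boxDensity u`. -/
noncomputable def tent (u : ℕ) : ℝ → ℝ := autoconv (boxDensity u)

theorem integrable_box_mul (x a : ℝ) :
    Integrable fun t => boxDensity u (t - a) * boxDensity u (x - t) :=
  (integrable_boxDensity.comp_sub_right a).mul_bdd
    (measurable_boxDensity.comp (measurable_const.sub measurable_id)).aestronglyMeasurable
    (ae_of_all _ fun _ => boxDensity_abs_le _)

theorem integral_box_mul (x a : ℝ) :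
    ∫ t, boxDensity u (t - a) * boxDensity u (x - t) = tent u (x - a) := by
  rw [tent, autoconv_apply,
    ← integral_sub_right_eq_self (fun t => boxDensity u t * boxDensity u (x - a - t)) a]
  refine integral_congr_ae (ae_of_all _ fun t => ?_)
  simp only
  congr 2
  ring

theorem tent_nonneg (x : ℝ) : 0 ≤ tent u x :=
  integral_nonneg fun _ => mul_nonneg (boxDensity_nonneg _) (boxDensity_nonneg _)

theorem integrable_tent : Integrable (tent u) := integrable_autoconv integrable_boxDensity

theorem integral_tent (hu : 0 < u) : ∫ x, tent u x = 1 := by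
  rw [tent, integral_autoconv integrable_boxDensity, integral_boxDensity hu, one_pow]

theorem tent_le (hu : 0 < u) (x : ℝ) : tent u x ≤ (u : ℝ)⁻¹ := by
  refine (le_abs_self _).trans
    ((autoconv_bound integrable_boxDensity boxDensity_abs_le x).trans_eq ?_)
  simp only [abs_of_nonneg (boxDensity_nonneg _), integral_boxDensity hu, one_mul]

theorem tent_norm_le (hu : 0 < u) (x : ℝ) : ‖tent u x‖ ≤ (u : ℝ)⁻¹ := by
  rw [Real.norm_of_nonneg (tent_nonneg x)]
  exact tent_le hu x

/-- The tent is an average of box translates, so it inherits the bound `sum_boxDensity_le`;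
`sum_tentCorr_le` repeats the averaging. -/
theorem sum_tent_le (hu : 0 < u) (x : ℝ) (S : Finset ℤ) : ∑ k ∈ S, tent u (x + k) ≤ 1 := by
  have hi : ∀ k : ℤ, Integrable fun t => boxDensity u t * boxDensity u (x + k - t) := fun k => by
    simpa using integrable_box_mul (u := u) (x + k) 0
  simp only [tent, autoconv_apply]
  rw [← integral_finsetSum _ fun k _ => hi k, ← integral_boxDensity hu]
  refine integral_mono (integrable_finsetSum _ fun k _ => hi k) integrable_boxDensity fun t => ?_
  simp only [← Finset.mul_sum]
  refine mul_le_of_le_one_right (boxDensity_nonneg _) ?_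
  simpa only [add_sub_right_comm] using sum_boxDensity_le (u := u) (x - t) S

/-- The correlation `∫ tent(x) tent(x + k) dx`. -/
noncomputable def tentCorr (u : ℕ) (k : ℤ) : ℝ := ∫ x, tent u x * tent u (x + k)

theorem integrable_tent_mul (hu : 0 < u) (a b : ℝ) :
    Integrable fun x => tent u (x + a) * tent u (x + b) :=
  (integrable_tent.comp_add_right a).mul_bdd
    (integrable_tent.comp_add_right b).aestronglyMeasurable (ae_of_all _ fun _ => tent_norm_le hu _)

theorem integrable_tent_mul' (hu : 0 < u) (b : ℝ) :
    Integrable fun x => tent u x * tent u (x + b) := by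
  simpa using integrable_tent_mul hu 0 b

theorem tentCorr_nonneg (k : ℤ) : 0 ≤ tentCorr u k :=
  integral_nonneg fun _ => mul_nonneg (tent_nonneg _) (tent_nonneg _)

theorem tentCorr_le (hu : 0 < u) (k : ℤ) : tentCorr u k ≤ (u : ℝ)⁻¹ := by
  rw [← one_mul (u : ℝ)⁻¹, ← integral_tent hu, ← integral_mul_const]
  exact integral_mono (integrable_tent_mul' hu k) (integrable_tent.mul_const _) fun x =>
    mul_le_mul_of_nonneg_left (tent_le hu _) (tent_nonneg _)

theorem sum_tentCorr_le (hu : 0 < u) (S : Finset ℤ) : ∑ k ∈ S, tentCorr u k ≤ 1 := by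
  have hi := fun k : ℤ => integrable_tent_mul' hu (k : ℝ)
  simp only [tentCorr]
  rw [← integral_finsetSum _ fun k _ => hi k, ← integral_tent hu]
  refine integral_mono (integrable_finsetSum _ fun k _ => hi k) integrable_tent fun t => ?_
  simp only [← Finset.mul_sum]
  exact mul_le_of_le_one_right (tent_nonneg _) (sum_tent_le hu _ _)

theorem autoconv_sum_box (A : Finset ℤ) (x : ℝ) :
    autoconv (fun x => ∑ a ∈ A, boxDensity u (x - a)) x =
      ∑ p ∈ A ×ˢ A, tent u (x - (p.1 + p.2 : ℤ)) := by
  rw [autoconv_apply]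
  have h : ∀ t : ℝ, (∑ a ∈ A, boxDensity u (t - a)) * ∑ a ∈ A, boxDensity u (x - t - a) =
      ∑ p ∈ A ×ˢ A, boxDensity u (t - p.1) * boxDensity u (x - p.2 - t) := fun t => by
    rw [Finset.sum_mul_sum, Finset.sum_product]
    simp only [sub_right_comm]
  simp only [h]
  rw [integral_finsetSum _ fun p _ => integrable_box_mul _ _]
  refine Finset.sum_congr rfl fun p _ => ?_
  rw [integral_box_mul]
  congr 1
  push_cast
  ring

/-- Expanding the square gives products of two tent translates, whose integral depends only on the
difference of the shifts. -/
theorem integral_autoconv_sum_box_sq (hu : 0 < u) (A : Finset ℤ) :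
    ∫ x, autoconv (fun x => ∑ a ∈ A, boxDensity u (x - a)) x ^ 2 =
      ∑ q ∈ (A ×ˢ A) ×ˢ (A ×ˢ A), tentCorr u (q.1.1 + q.1.2 - (q.2.1 + q.2.2)) := by
  simp only [autoconv_sum_box, sq, Finset.sum_mul_sum]
  simp only [← Finset.sum_product', sub_eq_add_neg]
  rw [integral_finsetSum _ fun p _ => integrable_tent_mul hu _ _]
  refine Finset.sum_congr rfl fun p _ => ?_
  rw [tentCorr, ← integral_sub_right_eq_self (fun x => tent u x * tent u (x + _))
    ((p.1.1 + p.1.2 : ℤ) : ℝ)]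
  refine integral_congr_ae (ae_of_all _ fun t => ?_)
  simp only
  congr 2
  push_cast
  ring

/-- The quadruple sum over a subset of `{1, …, N}` is bounded below by the autoconvolution
constant. -/
theorem muAutoconv_sq_mul_card_le (hu : 0 < u) {N : ℕ} {A : Finset ℤ}
    (hA : A ⊆ Finset.Icc 1 (N : ℤ)) (hne : A.Nonempty) :
    muAutoconv 2 ^ 2 * (A.card : ℝ) ^ 4 ≤ ((N : ℝ) + u) *
      ∑ q ∈ (A ×ˢ A) ×ˢ (A ×ˢ A), tentCorr u (q.1.1 + q.1.2 - (q.2.1 + q.2.2)) := by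
  have hu' : (0 : ℝ) < u := by exact_mod_cast hu
  have hX : (0 : ℝ) < A.card := by exact_mod_cast hne.card_pos
  rw [← integral_autoconv_sum_box_sq hu]
  -- The crude sup bound `C` only serves to make the autoconvolution square integrable.
  refine muAutoconv_sq_mul_le (C := A.card * (u : ℝ)⁻¹) ?_ ?_ (by positivity) hX ?_ ?_
  · exact integrable_finsetSum _ fun a _ => integrable_boxDensity.comp_sub_right _
  · intro x hx
    obtain ⟨a, ha, hxa⟩ := Finset.exists_ne_zero_of_sum_ne_zero hx
    obtain ⟨h1, h2⟩ := support_boxDensity hxa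
    obtain ⟨h3, h4⟩ := Finset.mem_Icc.1 (hA ha)
    have h3' : (1 : ℝ) ≤ a := by exact_mod_cast h3
    have h4' : (a : ℝ) ≤ N := by exact_mod_cast h4
    constructor <;> linarith
  · rw [integral_finsetSum _ fun a _ => integrable_boxDensity.comp_sub_right _]
    simp [integral_sub_right_eq_self (boxDensity u), integral_boxDensity hu]
  · intro x
    refine (Finset.abs_sum_le_sum_abs _ _).trans ?_
    rw [← nsmul_eq_mul]
    exact Finset.sum_le_card_nsmul _ _ _ fun a _ => boxDensity_abs_le _

end box

/-- The final bounds divide by `μ₂²`; a unit box shows that the infimum is finite. -/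
theorem muAutoconv_two_pos : 0 < muAutoconv 2 := by
  have hmem := rescale_mem_unitFamily (F := boxDensity 1) (M := 1) (X := 1) integrable_boxDensity
    (by simpa using (support_boxDensity (u := 1)).trans Set.Ico_subset_Icc_self) one_pos one_pos
    (integral_boxDensity one_pos)
  exact muAutoconv_two_pos_of_mem hmem
    (memLp_two_autoconv hmem.1 (rescale_abs_le one_pos one_pos boxDensity_abs_le))

/-! ### Counting in `B_h[g]`-sets -/

theorem Multiset.pair_eq_pair_cases {α : Type*} {a b c d : α}
    (h : ({a, b} : Multiset α) = {c, d}) : (a = c ∧ b = d) ∨ (a = d ∧ b = c) := by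
  rw [Multiset.insert_eq_cons, Multiset.insert_eq_cons, Multiset.cons_eq_cons] at h
  rcases h with ⟨h1, h2⟩ | ⟨-, cs, h2, h3⟩
  · exact Or.inl ⟨h1, Multiset.singleton_inj.1 h2⟩
  · have hc : cs = 0 := by simpa using congrArg Multiset.card h2
    subst hc
    exact Or.inr ⟨(Multiset.singleton_inj.1 h3).symm, Multiset.singleton_inj.1 h2⟩

/-- Turns an equality of `h`-fold sums into equality of the two sides of a difference. It follows by
comparing multiplicities at each point. -/
theorem Multiset.eq_of_add_eq_add_of_disjoint {α : Type*} [DecidableEq α] {s t s' t' : Multiset α}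
    (h : s + t' = s' + t) (hd : ∀ x ∈ s, x ∉ t) (hd' : ∀ x ∈ s', x ∉ t') : s = s' ∧ t = t' := by
  have key : s = s' := by
    ext x
    have hx := congrArg (Multiset.count x) h
    simp only [Multiset.count_add] at hx
    have h1 := hd x
    have h2 := hd' x
    simp only [← Multiset.count_pos] at h1 h2
    omega
  subst key
  exact ⟨rfl, (add_left_cancel h).symm⟩

namespace IsBhgSet

variable {A : Finset ℤ}

theorem eq_of_sum_eq {h : ℕ} (hA : IsBhgSet h 1 A) {s t : Multiset ℤ}
    (hs : s.card = h) (ht : t.card = h) (hsA : ∀ x ∈ s, x ∈ A) (htA : ∀ x ∈ t, x ∈ A)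
    (hst : s.sum = t.sum) : s = t := by
  have h1 := Finset.card_le_one.1 (hA t.sum) ⟨s, hs⟩
    (Finset.mem_filter.2 ⟨Finset.mem_sym_iff.2 fun a ha => hsA a ha, hst⟩) ⟨t, ht⟩
    (Finset.mem_filter.2 ⟨Finset.mem_sym_iff.2 fun a ha => htA a ha, rfl⟩)
  exact congrArg Subtype.val h1

/-- Each unordered representation has at most two orderings. -/
theorem card_pairs_le {g : ℕ} (hA : IsBhgSet 2 g A) (x : ℤ) :
    ((A ×ˢ A).filter fun p => p.1 + p.2 = x).card ≤ 2 * g := by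
  classical
  refine (Finset.card_le_mul_card_image_of_maps_to
    (f := fun p : ℤ × ℤ => (⟨{p.1, p.2}, rfl⟩ : Sym ℤ 2))
    (t := (A.sym 2).filter fun s : Sym ℤ 2 => (s : Multiset ℤ).sum = x) ?_ 2 ?_).trans
    (Nat.mul_le_mul_left _ (hA x))
  · intro p hp
    obtain ⟨h1, h2⟩ := Finset.mem_filter.1 hp
    obtain ⟨h3, h4⟩ := Finset.mem_product.1 h1
    refine Finset.mem_filter.2 ⟨Finset.mem_sym_iff.2 fun a ha => ?_, ?_⟩
    · have ha' : a ∈ ({p.1, p.2} : Multiset ℤ) := ha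
      simp only [Multiset.insert_eq_cons, Multiset.mem_cons, Multiset.mem_singleton] at ha'
      rcases ha' with rfl | rfl <;> assumption
    · change Multiset.sum {p.1, p.2} = x
      simpa using h2
  · intro s _
    rcases Finset.eq_empty_or_nonempty (((A ×ˢ A).filter fun p => p.1 + p.2 = x).filter
      fun p => (⟨{p.1, p.2}, rfl⟩ : Sym ℤ 2) = s) with h0 | ⟨q, hq⟩
    · rw [h0]
      exact Nat.zero_le _
    · refine (Finset.card_le_card (t := {(q.1, q.2), (q.2, q.1)}) fun p hp => ?_).trans
        Finset.card_le_two
      have h1 := (Finset.mem_filter.1 hp).2.trans (Finset.mem_filter.1 hq).2.symm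
      have h2 := Multiset.pair_eq_pair_cases (congrArg Subtype.val h1)
      simpa [Prod.ext_iff] using h2

theorem card_energy_le {g : ℕ} (hA : IsBhgSet 2 g A) :
    (((A ×ˢ A) ×ˢ (A ×ˢ A)).filter fun q => q.2.1 + q.2.2 = q.1.1 + q.1.2).card ≤
      A.card ^ 2 * (2 * g) := by
  rw [Finset.card_filter, Finset.sum_product]
  simp only [← Finset.card_filter]
  refine (Finset.sum_le_card_nsmul _ _ _ fun p _ => hA.card_pairs_le _).trans_eq ?_
  rw [Finset.card_product, smul_eq_mul, sq]

theorem card_offDiag_energy_add_le {g : ℕ} (hA : IsBhgSet 2 g A) :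
    ((A.offDiag ×ˢ A.offDiag).filter fun r => r.2.1 - r.2.2 = r.1.1 - r.1.2).card + A.card ^ 2 ≤
      A.card ^ 2 * (2 * g) := by
  refine le_trans ?_ hA.card_energy_le
  rw [← Finset.card_filter_add_card_filter_not
    (s := ((A ×ˢ A) ×ˢ (A ×ˢ A)).filter fun q => q.2.1 + q.2.2 = q.1.1 + q.1.2)
    (fun q : (ℤ × ℤ) × ℤ × ℤ => q.1.1 ≠ q.2.1)]
  -- The equation `d - b = a - c` is `a + b = c + d`, here with `a ≠ c`. The trivial solutions `(p,
  -- p)` have `a = c` and account for the remaining `|A|²`.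
  refine add_le_add (Finset.card_le_card_of_injOn
    (fun r : (ℤ × ℤ) × ℤ × ℤ => ((r.1.1, r.2.2), (r.1.2, r.2.1))) ?_ ?_) ?_
  · rintro ⟨⟨a, c⟩, d, b⟩ h
    simp only [Finset.coe_filter, Finset.mem_filter, Set.mem_ofPred_eq, Finset.mem_product,
      Finset.mem_offDiag] at h ⊢
    refine ⟨⟨⟨⟨h.1.1.1, h.1.2.2.1⟩, h.1.1.2.1, h.1.2.1⟩, ?_⟩, h.1.1.2.2⟩
    linarith [h.2]
  · rintro ⟨⟨a, c⟩, d, b⟩ - ⟨⟨a', c'⟩, d', b'⟩ - h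
    simp only [Prod.mk.injEq] at h ⊢
    tauto
  · rw [sq, ← Finset.card_product]
    refine Finset.card_le_card_of_injOn (fun p => (p, p)) ?_ fun p _ q _ h => (Prod.ext_iff.1 h).1
    rintro ⟨a, b⟩ h
    simp only [Finset.coe_product, Set.mem_prod, Finset.mem_coe] at h
    simp [h]

end IsBhgSet

/-- Quadruples `((a, b), (c, d))` with `{a, b}` and `{c, d}` disjoint. -/
def PairsDisjoint (q : (ℤ × ℤ) × ℤ × ℤ) : Prop :=
  (q.1.1 ≠ q.2.1 ∧ q.1.1 ≠ q.2.2) ∧ (q.1.2 ≠ q.2.1 ∧ q.1.2 ≠ q.2.2)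

instance : DecidablePred PairsDisjoint := fun _ => instDecidableAnd

/-- One of `a = c`, `a = d`, `b = c`, `b = d` holds, and each leaves three free elements. -/
theorem card_not_pairsDisjoint_le (A : Finset ℤ) :
    (((A ×ˢ A) ×ˢ (A ×ˢ A)).filter fun q => ¬ PairsDisjoint q).card ≤ 4 * A.card ^ 3 := by
  have hsub : (((A ×ˢ A) ×ˢ (A ×ˢ A)).filter fun q => ¬ PairsDisjoint q) ⊆
      (((A ×ˢ A) ×ˢ A).image (fun p => ((p.1.1, p.1.2), (p.1.1, p.2))) ∪
        ((A ×ˢ A) ×ˢ A).image (fun p => ((p.1.1, p.1.2), (p.2, p.1.1)))) ∪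
      (((A ×ˢ A) ×ˢ A).image (fun p => ((p.1.1, p.1.2), (p.1.2, p.2))) ∪
        ((A ×ˢ A) ×ˢ A).image (fun p => ((p.1.1, p.1.2), (p.2, p.1.2)))) := by
    rintro ⟨⟨a, b⟩, c, d⟩ h
    simp only [Finset.mem_filter, Finset.mem_product] at h
    simp only [PairsDisjoint] at h
    simp only [Finset.mem_union, Finset.mem_image, Finset.mem_product, Prod.mk.injEq, Prod.exists]
    by_cases h1 : a = c
    · exact Or.inl (Or.inl ⟨a, b, d, by tauto⟩)
    by_cases h2 : a = d
    · exact Or.inl (Or.inr ⟨a, b, c, by tauto⟩)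
    by_cases h3 : b = c
    · exact Or.inr (Or.inl ⟨a, b, d, by tauto⟩)
    · exact Or.inr (Or.inr ⟨a, b, c, by tauto⟩)
  have hc : ∀ f : (ℤ × ℤ) × ℤ → (ℤ × ℤ) × ℤ × ℤ,
      (((A ×ˢ A) ×ˢ A).image f).card ≤ A.card ^ 3 := fun f =>
    Finset.card_image_le.trans_eq (by rw [Finset.card_product, Finset.card_product]; ring)
  refine (Finset.card_le_card hsub).trans ((Finset.card_union_le _ _).trans ((add_le_add
    ((Finset.card_union_le _ _).trans (add_le_add (hc _) (hc _)))
    ((Finset.card_union_le _ _).trans (add_le_add (hc _) (hc _)))).trans_eq ?_))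
  ring

/-! ### Weighted sums over quadruples -/

section weights

variable {V : ℤ → ℝ}

theorem sum_comp_le_of_card_fiber_le {ι : Type*} (h0 : ∀ k, 0 ≤ V k)
    (h1 : ∀ S : Finset ℤ, ∑ k ∈ S, V k ≤ 1) (Q : Finset ι) (κ : ι → ℤ) (m : ℕ)
    (hm : ∀ q₀ ∈ Q, (Q.filter fun q => κ q = κ q₀).card ≤ m) : ∑ q ∈ Q, V (κ q) ≤ m := by
  rw [Finset.sum_comp V κ]
  calc ∑ b ∈ Q.image κ, (Q.filter fun q => κ q = b).card • V b
      ≤ ∑ b ∈ Q.image κ, (m : ℝ) * V b := Finset.sum_le_sum fun b hb => by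
        obtain ⟨q, hq, rfl⟩ := Finset.mem_image.1 hb
        rw [nsmul_eq_mul]
        exact mul_le_mul_of_nonneg_right (by exact_mod_cast hm q hq) (h0 _)
    _ ≤ m := by
        rw [← Finset.mul_sum]
        exact mul_le_of_le_one_right (Nat.cast_nonneg _) (h1 _)

/-- Schur's test: with `D` the fibre sizes of `δ`, use `D k * D l ≤ (D k ^ 2 + D l ^ 2) / 2` and the
fact that every row and column sum of `V (k - l)` is at most `1`. -/
theorem sum_sub_comp_le_card {ι : Type*} (h0 : ∀ k, 0 ≤ V k)
    (h1 : ∀ S : Finset ℤ, ∑ k ∈ S, V k ≤ 1) (P : Finset ι) (δ : ι → ℤ) :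
    ∑ r ∈ P ×ˢ P, V (δ r.1 - δ r.2) ≤ ((P ×ˢ P).filter fun r => δ r.2 = δ r.1).card := by
  set K := P.image δ
  set D : ℤ → ℝ := fun k => (P.filter fun p => δ p = k).card
  have hL : ∑ r ∈ P ×ˢ P, V (δ r.1 - δ r.2) = ∑ k ∈ K, ∑ l ∈ K, D k * D l * V (k - l) := by
    rw [Finset.sum_product]
    simp only
    rw [Finset.sum_comp (fun k => ∑ q ∈ P, V (k - δ q)) δ]
    refine Finset.sum_congr rfl fun k _ => ?_
    rw [Finset.sum_comp (fun l => V (k - l)) δ, nsmul_eq_mul, Finset.mul_sum]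
    simp only [nsmul_eq_mul, mul_assoc, D, K]
  have hR : (((P ×ˢ P).filter fun r => δ r.2 = δ r.1).card : ℝ) = ∑ k ∈ K, D k ^ 2 := by
    rw [Finset.card_filter, Finset.sum_product]
    simp only [← Finset.card_filter]
    push_cast
    rw [Finset.sum_comp D δ]
    simp only [nsmul_eq_mul, sq, D, K]
  have hl : ∀ k, ∑ l ∈ K, V (k - l) ≤ 1 := fun k => by
    rw [← Finset.sum_image (f := V) (g := fun l => k - l) fun x _ y _ h => by simpa using h]
    exact h1 _
  have hk : ∀ l, ∑ k ∈ K, V (k - l) ≤ 1 := fun l => by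
    rw [← Finset.sum_image (f := V) (g := fun k => k - l) fun x _ y _ h => by simpa using h]
    exact h1 _
  rw [hL, hR]
  calc ∑ k ∈ K, ∑ l ∈ K, D k * D l * V (k - l)
      ≤ ∑ k ∈ K, ∑ l ∈ K, (D k ^ 2 / 2 * V (k - l) + D l ^ 2 / 2 * V (k - l)) :=
        Finset.sum_le_sum fun k _ => Finset.sum_le_sum fun l _ => by
          rw [← add_mul]
          exact mul_le_mul_of_nonneg_right (by nlinarith [sq_nonneg (D k - D l)]) (h0 _)
    _ = ∑ k ∈ K, D k ^ 2 / 2 * ∑ l ∈ K, V (k - l) + ∑ l ∈ K, D l ^ 2 / 2 * ∑ k ∈ K, V (k - l) := by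
        simp only [Finset.sum_add_distrib, Finset.mul_sum]
        congr 1
        exact Finset.sum_comm
    _ ≤ ∑ k ∈ K, D k ^ 2 / 2 + ∑ l ∈ K, D l ^ 2 / 2 := by
        gcongr <;> exact mul_le_of_le_one_right (by positivity) (by first | exact hl _ | exact hk _)
    _ = ∑ k ∈ K, D k ^ 2 := by
        rw [← Finset.sum_add_distrib]
        exact Finset.sum_congr rfl fun k _ => by ring

/-- The quadruple sum exceeds the sum over quadruples with disjoint pairs by a small amount. -/
theorem quadruple_sum_le {M : ℝ} (hM : 0 ≤ M) (hV : ∀ k, V k ≤ M) (A : Finset ℤ) :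
    ∑ q ∈ (A ×ˢ A) ×ˢ (A ×ˢ A), V (q.1.1 + q.1.2 - (q.2.1 + q.2.2)) ≤
      ∑ q ∈ ((A ×ˢ A) ×ˢ (A ×ˢ A)).filter PairsDisjoint, V (q.1.1 + q.1.2 - (q.2.1 + q.2.2)) +
        4 * (A.card : ℝ) ^ 3 * M := by
  rw [← Finset.sum_filter_add_sum_filter_not _ PairsDisjoint]
  gcongr
  refine (Finset.sum_le_card_nsmul _ _ M fun q _ => hV _).trans ?_
  rw [nsmul_eq_mul]
  gcongr
  exact_mod_cast card_not_pairsDisjoint_le A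

/-- Write `a + b - (c + d) = (a - c) - (d - b)`. Disjointness makes both differences off-diagonal,
which improves `2g` to `2g - 1`. -/
theorem disjoint_sum_le_of_two {A : Finset ℤ} {g : ℕ} (hA : IsBhgSet 2 g A) (h0 : ∀ k, 0 ≤ V k)
    (h1 : ∀ S : Finset ℤ, ∑ k ∈ S, V k ≤ 1) :
    ∑ q ∈ ((A ×ˢ A) ×ˢ (A ×ˢ A)).filter PairsDisjoint, V (q.1.1 + q.1.2 - (q.2.1 + q.2.2)) ≤
      (2 * g - 1) * (A.card : ℝ) ^ 2 := by
  have hE := hA.card_offDiag_energy_add_le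
  have hE' : (((A.offDiag ×ˢ A.offDiag).filter fun r => r.2.1 - r.2.2 = r.1.1 - r.1.2).card : ℝ) +
      (A.card : ℝ) ^ 2 ≤ (A.card : ℝ) ^ 2 * (2 * g) := by exact_mod_cast hE
  have hS := sum_sub_comp_le_card h0 h1 A.offDiag fun p => p.1 - p.2
  have hinj : Set.InjOn (fun q : (ℤ × ℤ) × ℤ × ℤ => ((q.1.1, q.2.1), (q.2.2, q.1.2)))
      (((A ×ˢ A) ×ˢ (A ×ˢ A)).filter PairsDisjoint) := by
    rintro ⟨⟨a, b⟩, c, d⟩ - ⟨⟨a', b'⟩, c', d'⟩ - h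
    simp only [Prod.mk.injEq] at h ⊢
    tauto
  have hT : ∑ q ∈ ((A ×ˢ A) ×ˢ (A ×ˢ A)).filter PairsDisjoint,
      V (q.1.1 + q.1.2 - (q.2.1 + q.2.2)) ≤
      ∑ r ∈ A.offDiag ×ˢ A.offDiag, V ((r.1.1 - r.1.2) - (r.2.1 - r.2.2)) := by
    rw [Finset.sum_congr rfl fun q _ => show V (q.1.1 + q.1.2 - (q.2.1 + q.2.2)) =
        (fun r : (ℤ × ℤ) × ℤ × ℤ => V ((r.1.1 - r.1.2) - (r.2.1 - r.2.2)))
          ((q.1.1, q.2.1), (q.2.2, q.1.2)) by congr 1; simp only; ring,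
      ← Finset.sum_image (f := fun r : (ℤ × ℤ) × ℤ × ℤ => V ((r.1.1 - r.1.2) - (r.2.1 - r.2.2)))
        hinj]
    refine Finset.sum_le_sum_of_subset_of_nonneg ?_ fun _ _ _ => h0 _
    intro r hr
    obtain ⟨q, hq, rfl⟩ := Finset.mem_image.1 hr
    simp only [Finset.mem_filter, Finset.mem_product] at hq
    simp only [PairsDisjoint] at hq
    simp only [Finset.mem_product, Finset.mem_offDiag]
    have h3 := hq.2.2.2.symm
    tauto
  linarith

theorem disjoint_sum_le_of_three {A : Finset ℤ} (hA : IsBhgSet 3 1 A) (h0 : ∀ k, 0 ≤ V k)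
    (h1 : ∀ S : Finset ℤ, ∑ k ∈ S, V k ≤ 1) :
    ∑ q ∈ ((A ×ˢ A) ×ˢ (A ×ˢ A)).filter PairsDisjoint, V (q.1.1 + q.1.2 - (q.2.1 + q.2.2)) ≤
      2 * (A.card : ℝ) := by
  set Q := ((A ×ˢ A) ×ˢ (A ×ˢ A)).filter PairsDisjoint with hQ
  have hmaps : ∀ q ∈ Q, q.2.2 ∈ A := fun q hq => by
    simp only [hQ, Finset.mem_filter, Finset.mem_product] at hq
    exact hq.1.2.2
  rw [← Finset.sum_fiberwise_of_maps_to hmaps, mul_comm, ← nsmul_eq_mul]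
  refine Finset.sum_le_card_nsmul _ _ _ fun d _ => ?_
  refine sum_comp_le_of_card_fiber_le h0 h1 _ _ 2 fun q₀ hq₀ => ?_
  refine (Finset.card_le_card (t := {((q₀.1.1, q₀.1.2), q₀.2), ((q₀.1.2, q₀.1.1), q₀.2)})
    fun q hq => ?_).trans Finset.card_le_two
  obtain ⟨⟨a, b⟩, c, e⟩ := q₀
  obtain ⟨⟨a', b'⟩, c', e'⟩ := q
  simp only [hQ, Finset.mem_filter, Finset.mem_product] at hq hq₀
  simp only [PairsDisjoint] at hq hq₀
  obtain ⟨⟨⟨⟨⟨ha', hb'⟩, hc', -⟩, ⟨hac', -⟩, hbc', -⟩, hd'⟩, hk⟩ := hq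
  obtain ⟨⟨⟨⟨ha, hb⟩, hc, -⟩, ⟨hac, -⟩, hbc, -⟩, hd⟩ := hq₀
  -- With `d` fixed, equal values of `a + b - c - d` give `a + b + c' = a' + b' + c`, a coincidence
  -- of 3-fold sums. Only the order of `a, b` stays free.
  have key := hA.eq_of_sum_eq (s := {a, b} + {c'}) (t := {a', b'} + {c}) rfl rfl
    (by simp [ha, hb, hc']) (by simp [ha', hb', hc]) (by simp; linarith)
  obtain ⟨h2, h3⟩ := Multiset.eq_of_add_eq_add_of_disjoint key (by simp [hac, hbc])
    (by simp [hac', hbc'])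
  have h4 := Multiset.pair_eq_pair_cases h2
  have h5 := Multiset.singleton_inj.1 h3
  simp only [Finset.mem_insert, Finset.mem_singleton, Prod.mk.injEq]
  have h6 := hd'.trans hd.symm
  tauto

theorem disjoint_sum_le_of_four {A : Finset ℤ} (hA : IsBhgSet 4 1 A) (h0 : ∀ k, 0 ≤ V k)
    (h1 : ∀ S : Finset ℤ, ∑ k ∈ S, V k ≤ 1) :
    ∑ q ∈ ((A ×ˢ A) ×ˢ (A ×ˢ A)).filter PairsDisjoint, V (q.1.1 + q.1.2 - (q.2.1 + q.2.2)) ≤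
      4 := by
  refine sum_comp_le_of_card_fiber_le h0 h1 _ _ 4 fun q₀ hq₀ => ?_
  refine (Finset.card_le_card (t := {(q₀.1.1, q₀.1.2), (q₀.1.2, q₀.1.1)} ×ˢ
    {(q₀.2.1, q₀.2.2), (q₀.2.2, q₀.2.1)}) fun q hq => ?_).trans
    ((Finset.card_product _ _).trans_le
      (Nat.mul_le_mul Finset.card_le_two Finset.card_le_two))
  obtain ⟨⟨a, b⟩, c, d⟩ := q₀
  obtain ⟨⟨a', b'⟩, c', d'⟩ := q
  simp only [Finset.mem_filter, Finset.mem_product] at hq hq₀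
  simp only [PairsDisjoint] at hq hq₀
  obtain ⟨⟨⟨⟨ha', hb'⟩, hc', hd'⟩, ⟨hac', had'⟩, hbc', hbd'⟩, hk⟩ := hq
  obtain ⟨⟨⟨ha, hb⟩, hc, hd⟩, ⟨hac, had⟩, hbc, hbd⟩ := hq₀
  -- Moving the negative terms across gives two equal 4-fold sums. Disjointness then determines both
  -- pairs up to order.
  have key := hA.eq_of_sum_eq (s := {a, b} + {c', d'}) (t := {a', b'} + {c, d}) rfl rfl
    (by simp [ha, hb, hc', hd']) (by simp [ha', hb', hc, hd]) (by simp; linarith)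
  obtain ⟨h2, h3⟩ := Multiset.eq_of_add_eq_add_of_disjoint key (by simp [hac, hbc, had, hbd])
    (by simp [hac', hbc', had', hbd'])
  have h4 := Multiset.pair_eq_pair_cases h2
  have h5 := Multiset.pair_eq_pair_cases h3
  simp only [Finset.mem_insert, Finset.mem_singleton, Prod.mk.injEq, Finset.mem_product]
  grind

end weights

/-! ### Passage to the limit -/

theorem exists_isBhgSet_card_eq {h g N : ℕ} (hpos : 0 < maxBhg h g N) :
    ∃ A ⊆ Finset.Icc (1 : ℤ) N, IsBhgSet h g A ∧ A.card = maxBhg h g N := by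
  classical
  rcases Finset.eq_empty_or_nonempty
    ((Finset.Icc (1 : ℤ) (N : ℤ)).powerset.filter (fun A => IsBhgSet h g A)) with h0 | h0
  · simp only [maxBhg] at hpos
    simp [h0] at hpos
  · obtain ⟨A, hA, hc⟩ := Finset.exists_mem_eq_sup _ h0 Finset.card
    obtain ⟨h1, h2⟩ := Finset.mem_filter.1 hA
    exact ⟨A, Finset.mem_powerset.1 h1, h2, by rw [maxBhg, ← hc]⟩

/-- A bound for `R_h[g](N)` with a free window length `u` gives a bound for `σ_h(g)` on taking
`u = εN`. -/
theorem sigmaSup_le_of_window_bound {h g : ℕ} (hh : 1 ≤ h) (hg : 1 ≤ g) {μ C : ℝ} (hμ : 0 < μ)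
    (hC : 0 ≤ C)
    (H : ∀ N u R : ℕ, 0 < u → 0 < R → R = maxBhg h g N →
      μ ≤ ((N : ℝ) + u) * (C / (R : ℝ) ^ h + 4 / (R * u))) :
    sigmaSup h g ≤ (((C / g / μ) ^ (1 / (h : ℝ)) : ℝ) : EReal) := by
  have hg' : (0 : ℝ) < g := by exact_mod_cast hg
  have hh' : (0 : ℝ) < h := by exact_mod_cast hh
  refine EReal.le_of_forall_lt_iff_le.1 fun s hs => ?_
  have hs : (C / g / μ) ^ (1 / (h : ℝ)) < s := by exact_mod_cast hs
  have hB : 0 ≤ (C / g / μ) ^ (1 / (h : ℝ)) := by positivity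
  have hs0 : 0 < s := hB.trans_lt hs
  have hsh : C / (s ^ h * g) < μ := by
    have h1 := pow_lt_pow_left₀ hs hB (by omega : h ≠ 0)
    rw [← Real.rpow_natCast, ← Real.rpow_mul (by positivity), one_div_mul_cancel hh'.ne',
      Real.rpow_one, div_lt_iff₀ hμ, div_lt_iff₀ hg'] at h1
    rw [div_lt_iff₀ (by positivity)]
    linarith
  obtain ⟨ε, hε, hε'⟩ : ∃ ε : ℝ, 0 < ε ∧ (1 + ε) * (C / (s ^ h * g)) < μ := by
    have ht : Tendsto (fun ε : ℝ => (1 + ε) * (C / (s ^ h * g))) (𝓝[>] 0)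
        (𝓝 ((1 + 0) * (C / (s ^ h * g)))) :=
      ((continuous_const.add continuous_id).mul continuous_const).tendsto' _ _ rfl
        |>.mono_left nhdsWithin_le_nhds
    obtain ⟨ε, h1, h2⟩ := ((ht.eventually_lt_const (by simpa using hsh)).and
      self_mem_nhdsWithin).exists
    exact ⟨ε, h2, h1⟩
  -- This bounds the right side of `H` when `R > s (gN)^(1/h)` and `u = ⌈εN⌉`; the term `1 / N` pays
  -- for the rounding.
  have hlim : Tendsto (fun N : ℕ => ((1 + ε) + 1 / (N : ℝ)) *
      (C / (s ^ h * g) + 4 / (s * ε) * ((g : ℝ) * N) ^ (-(1 / (h : ℝ))))) atTop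
      (𝓝 (((1 + ε) + 0) * (C / (s ^ h * g) + 4 / (s * ε) * 0))) := by
    refine (tendsto_const_nhds.add tendsto_one_div_atTop_nhds_zero_nat).mul
      (tendsto_const_nhds.add (tendsto_const_nhds.mul ?_))
    exact (tendsto_rpow_neg_atTop (by positivity)).comp
      (tendsto_natCast_atTop_atTop.const_mul_atTop hg')
  refine limsup_le_of_le (h := ?_)
  filter_upwards [hlim.eventually_lt_const (by simpa using hε'), eventually_ge_atTop 1]
    with N hN hN1
  have hN0 : (0 : ℝ) < N := by exact_mod_cast hN1
  rw [EReal.coe_le_coe_iff]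
  by_contra! hlt
  set X : ℝ := ((g : ℝ) * N) ^ (1 / (h : ℝ)) with hX
  have hX0 : 0 < X := by positivity
  rw [lt_div_iff₀ hX0] at hlt
  have hR : 0 < maxBhg h g N := by
    have : (0 : ℝ) < maxBhg h g N := (mul_pos hs0 hX0).trans hlt
    exact_mod_cast this
  have hu : 0 < ⌈ε * N⌉₊ := Nat.ceil_pos.2 (by positivity)
  have hu1 : ε * N ≤ ⌈ε * N⌉₊ := Nat.le_ceil _
  have hu2 : (⌈ε * N⌉₊ : ℝ) ≤ ε * N + 1 := (Nat.ceil_lt_add_one (by positivity)).le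
  have hXh : X ^ h = g * N := by
    rw [hX, ← Real.rpow_natCast, ← Real.rpow_mul (by positivity), one_div_mul_cancel hh'.ne',
      Real.rpow_one]
  refine absurd (H N _ _ hu hR rfl) (not_le.2 (lt_of_le_of_lt ?_ hN))
  calc ((N : ℝ) + ⌈ε * N⌉₊) * (C / (maxBhg h g N : ℝ) ^ h + 4 / (maxBhg h g N * ⌈ε * N⌉₊))
      ≤ ((N : ℝ) + (ε * N + 1)) * (C / (s * X) ^ h + 4 / (s * X * (ε * N))) := by gcongr
    _ = _ := by
      rw [mul_pow, hXh, Real.rpow_neg (by positivity), ← hX]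
      field_simp
      ring

/-- An upper bound for the disjoint part of all quadruple sums over a `B_h[g]`-set bounds
`σ_h(g)`. -/
theorem sigmaSup_le_of_disjoint_sum_le {h g j : ℕ} (hh : 1 ≤ h) (hg : 1 ≤ g) (hj : h + j = 4)
    {C : ℝ} (hC : 0 ≤ C)
    (H : ∀ A : Finset ℤ, IsBhgSet h g A → ∀ V : ℤ → ℝ, (∀ k, 0 ≤ V k) →
      (∀ S : Finset ℤ, ∑ k ∈ S, V k ≤ 1) →
      ∑ q ∈ ((A ×ˢ A) ×ˢ (A ×ˢ A)).filter PairsDisjoint, V (q.1.1 + q.1.2 - (q.2.1 + q.2.2)) ≤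
        C * (A.card : ℝ) ^ j) :
    sigmaSup h g ≤ (((C / g / muAutoconv 2 ^ 2) ^ (1 / (h : ℝ)) : ℝ) : EReal) := by
  refine sigmaSup_le_of_window_bound hh hg (pow_pos muAutoconv_two_pos 2) hC ?_
  rintro N u R hu hR0 hR
  obtain ⟨A, hAN, hA, hcard⟩ := exists_isBhgSet_card_eq (hR ▸ hR0)
  rw [← hR] at hcard
  have hR0' : (0 : ℝ) < R := by exact_mod_cast hR0
  have hu' : (0 : ℝ) < u := by exact_mod_cast hu
  have h1 := muAutoconv_sq_mul_card_le hu hAN (Finset.card_pos.1 (hcard ▸ hR0))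
  have h2 := quadruple_sum_le (by positivity) (tentCorr_le hu) A
  have h3 := H A hA _ tentCorr_nonneg (sum_tentCorr_le hu)
  rw [hcard] at h1 h2 h3
  rw [← le_div_iff₀ (by positivity)] at h1
  refine h1.trans ?_
  rw [div_le_iff₀ (by positivity), mul_assoc]
  gcongr
  refine h2.trans ((add_le_add_left h3 _).trans_eq ?_)
  -- Since `h + j = 4`, dividing `C|A|^j` by `|A|⁴` leaves `C/|A|^h`.
  rw [← hj, pow_add, add_mul]
  congr 1
  · field_simp
  · rw [← pow_add, hj]
    field_simp

theorem corollary1p2 :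
    (∀ g : ℕ, 1 ≤ g →
      sigmaSup 2 g ≤ ((((2 - 1 / (g : ℝ)) / muAutoconv 2 ^ 2) ^ ((1 : ℝ) / 2) : ℝ) : EReal)) ∧
    sigmaSup 3 1 ≤ (((2 / muAutoconv 2 ^ 2) ^ ((1 : ℝ) / 3) : ℝ) : EReal) ∧
    sigmaSup 4 1 ≤ (((4 / muAutoconv 2 ^ 2) ^ ((1 : ℝ) / 4) : ℝ) : EReal) := by
  refine ⟨fun g hg => ?_, ?_, ?_⟩
  · have hg' : (1 : ℝ) ≤ g := by exact_mod_cast hg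
    have h := sigmaSup_le_of_disjoint_sum_le (h := 2) (g := g) (j := 2) (C := 2 * g - 1)
      (by norm_num) hg rfl (by linarith) fun A hA V h0 h1 => disjoint_sum_le_of_two hA h0 h1
    rwa [sub_div, mul_div_cancel_right₀ _ (by linarith)] at h
  · simpa using sigmaSup_le_of_disjoint_sum_le (h := 3) (g := 1) (j := 1) (C := 2)
      (by norm_num) le_rfl rfl (by norm_num) fun A hA V h0 h1 => by
        simpa using disjoint_sum_le_of_three hA h0 h1
  · simpa using sigmaSup_le_of_disjoint_sum_le (h := 4) (g := 1) (j := 0) (C := 4)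
      (by norm_num) le_rfl rfl (by norm_num) fun A hA V h0 h1 => by
        simpa using disjoint_sum_le_of_four hA h0 h1
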